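/- Let $V=(V,Y,\mathbf 1,\omega)$ be a vertex operator algebra over $\mathbb C$ and let $g$ be an arbitrary automorphism of $V$. Write $g=e^{2\pi i\mathcal L}$ on each (finite-dimensional) weight space $V_{(m)}$, with commuting $\mathcal S$ semisimple, $\mathcal N$ nilpotent, $\mathcal L=\mathcal S+\mathcal N$, and the eigenvalues of $\mathcal S$ having real part in $[0,1)$. Let $P(V)$ be the set of eigenvalues of $\mathcal S$ on $V$, let $V^{[\alpha]}=\{v\in V:\mathcal S v=\alpha v\}$, and let $V_+=\coprod_{m>0}V_{(m)}$. A weak $g$-twisted $V$-module is a complex vector space $W$ with a linear map $u\mapsto Y_W(u,x)=\sum_{k=0}^{K}\sum_{n\in\mathbb C}u(n,k)x^{-n-1}(\log x)^k$ from $V$ to $(\mathrm{End}\,W)\{x\}[\log x]$ such that: (1) for all $u\in V$, $w\in W$, $n\in\mathbb C$, $k\ge 0$, $u(n+l,k)w=0$ for all sufficiently large $l\in\mathbb Z$; (2) $Y_W(\mathbf 1,x)=\mathrm{id}_W$; (3) for all $u,v\in V$, $$x_0^{-1}\delta\Big(\tfrac{x_1-x_2}{x_0}\Big)Y_W(u,x_1)Y_W(v,x_2)-x_0^{-1}\delta\Big(\tfrac{-x_2+x_1}{x_0}\Big)Y_W(v,x_2)Y_W(u,x_1)=x_1^{-1}\delta\Big(\tfrac{x_2+x_0}{x_1}\Big)Y_W\Big(Y\Big(\big(\tfrac{x_2+x_0}{x_1}\big)^{\mathcal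 L}u,x_0\Big)v,x_2\Big);$$ (4) $e^{2\pi i x\frac{d}{dx}}Y_W(gu,x)=Y_W(u,x)$ for all $u\in V$, where $e^{2\pi i x\frac{d}{dx}}$ replaces $x^{n}(\log x)^k$ by $e^{2\pi i n}x^{n}(\log x+2\pi i)^k$. For $n\ge 1$ let $C_n(W)$ be the span of all $u(\alpha-n,0)w$ with $\alpha\in P(V)$, $u\in V^{[\alpha]}$, $w\in W$, where for $n=1$ one also requires $u\in V_+$. Call $W$ $C_n$-cofinite if $\dim W/C_n(W)<\infty$. Call $V$ of CFT type if $V_{(m)}=0$ for $m<0$ and $V_{(0)}=\mathbb C\mathbf 1$. **Proposition.** Let $W$ be a weak $g$-twisted $V$-module. For every integer $n\ge 3$, $C_n(W)\subseteq C_{n-1}(W)$, and if $W$ is $C_n$-cofinite then $W$ is $C_{n-1}$-cofinite. Furthermore, if $V$ is of CFT type and $W$ is $C_2$-cofinite, then $W$ is $C_1$-cofinite. -/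

import Mathlib

noncomputable section

open VertexOperator (ncoeff)

/-! ### The logarithm of an invertible operator with generalized eigenspace decomposition -/

namespace OperatorLog

variable {V : Type*} [AddCommGroup V] [Module ℂ V]

/-- The logarithm `α` of `z`, divided by `2πi`, normalized so that `0 ≤ Re α < 1`
(so `exp (2πi α) = z` when `z ≠ 0`). -/
def exponent (z : ℂ) : ℂ :=
  Complex.log z / (2 * Real.pi * Complex.I)
    - (⌊(Complex.log z / (2 * Real.pi * Complex.I)).re⌋ : ℂ)

theorem exponent_re_nonneg (z : ℂ) : 0 ≤ (exponent z).re := by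
  simp only [exponent, Complex.sub_re, Complex.intCast_re]
  exact Int.fract_nonneg _

theorem exponent_re_lt_one (z : ℂ) : (exponent z).re < 1 := by
  simp only [exponent, Complex.sub_re, Complex.intCast_re]
  exact Int.fract_lt_one _

theorem exp_exponent {z : ℂ} (hz : z ≠ 0) :
    Complex.exp (2 * Real.pi * Complex.I * exponent z) = z := by
  have h : (2 * Real.pi * Complex.I : ℂ) ≠ 0 := Complex.two_pi_I_ne_zero
  rw [exponent, mul_sub, mul_div_cancel₀ _ h, Complex.exp_sub, Complex.exp_log hz,
    mul_comm, Complex.exp_int_mul_two_pi_mul_I, div_one]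

theorem isInternal_maxGenEigenspace (g : Module.End ℂ V)
    (hg : ⨆ z, g.maxGenEigenspace z = ⊤) :
    DirectSum.IsInternal fun z : ℂ => g.maxGenEigenspace z :=
  (DirectSum.isInternal_submodule_iff_iSupIndep_and_iSup_eq_top _).mpr
    ⟨g.independent_maxGenEigenspace, hg⟩

/-- When `V` is the direct sum of the generalized eigenspaces of `g`, the operator that
acts on the generalized eigenspace for `z` as the scalar `c z`. -/
def scalarOp (g : Module.End ℂ V) (hg : ⨆ z, g.maxGenEigenspace z = ⊤) (c : ℂ → ℂ) :
    Module.End ℂ V :=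
  (DirectSum.toModule ℂ ℂ V fun z => c z • (g.maxGenEigenspace z).subtype) ∘ₗ
    (LinearEquiv.ofBijective (DirectSum.coeLinearMap fun z : ℂ => g.maxGenEigenspace z)
      (isInternal_maxGenEigenspace g hg)).symm.toLinearMap

theorem scalarOp_apply (g : Module.End ℂ V) (hg : ⨆ z, g.maxGenEigenspace z = ⊤)
    (c : ℂ → ℂ) {z : ℂ} {v : V} (hv : v ∈ g.maxGenEigenspace z) :
    scalarOp g hg c v = c z • v := by
  have : (LinearEquiv.ofBijective (DirectSum.coeLinearMap fun z : ℂ => g.maxGenEigenspace z)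
      (isInternal_maxGenEigenspace g hg)).symm v =
      DirectSum.lof ℂ ℂ (fun z : ℂ => g.maxGenEigenspace z) z ⟨v, hv⟩ := by
    rw [LinearEquiv.symm_apply_eq]
    exact (DirectSum.coeLinearMap_lof (fun z : ℂ => g.maxGenEigenspace z) z ⟨v, hv⟩).symm
  simp [scalarOp, this]

/-- The unipotent part `e^{-2πi S} g` of `g`, where `e^{2πi S}` is the semisimple part: on the
generalized eigenspace for `z` it is `z⁻¹ g`. -/
def unipotentPart (g : Module.End ℂ V) (hg : ⨆ z, g.maxGenEigenspace z = ⊤) :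
    Module.End ℂ V :=
  scalarOp g hg (fun z => z⁻¹) * g

theorem unipotentPart_locally (g : Module.End ℂ V) (hg : ⨆ z, g.maxGenEigenspace z = ⊤)
    (hinj : Function.Injective g) (v : V) :
    ∃ K : ℕ, ((unipotentPart g hg - 1) ^ K) v = 0 := by
  suffices h : v ∈ (unipotentPart g hg).maxGenEigenspace 1 by
    simpa [Module.End.mem_maxGenEigenspace] using h
  have hv : v ∈ ⨆ z, g.maxGenEigenspace z := hg ▸ Submodule.mem_top
  refine (iSup_le fun z w hw => ?_ : ⨆ z, g.maxGenEigenspace z ≤ _) hv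
  obtain ⟨K, hK⟩ := (Module.End.mem_maxGenEigenspace g z w).mp hw
  rw [Module.End.mem_maxGenEigenspace]
  refine ⟨K, ?_⟩
  rcases eq_or_ne z 0 with rfl | hz
  · have : w = 0 := by
      have h0 : (g ^ K) w = 0 := by simpa using hK
      have hi : Function.Injective (g ^ K) := by
        rw [Module.End.coe_pow]; exact hinj.iterate K
      exact hi (by simpa using h0)
    simp [this]
  · have hmaps : ∀ x ∈ g.maxGenEigenspace z, g x ∈ g.maxGenEigenspace z :=
      Module.End.mapsTo_maxGenEigenspace_of_comm (Commute.refl g) z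
    have key : ∀ k : ℕ, ((unipotentPart g hg - (1 : ℂ) • 1) ^ k) w =
        (z⁻¹ ^ k) • ((g - z • 1) ^ k) w ∧ ((g - z • 1) ^ k) w ∈ g.maxGenEigenspace z := by
      intro k
      induction k with
      | zero => simpa using hw
      | succ k ih =>
        obtain ⟨h1, h2⟩ := ih
        have h3 := hmaps _ h2
        refine ⟨?_, ?_⟩
        · rw [pow_succ', Module.End.mul_apply, h1, pow_succ' (g - z • 1), Module.End.mul_apply,
            map_smul]
          simp only [unipotentPart, LinearMap.sub_apply, Module.End.mul_apply,
            LinearMap.smul_apply, Module.End.one_apply, one_smul]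
          rw [scalarOp_apply g hg _ h3, pow_succ, mul_smul, smul_sub, smul_sub, smul_smul z⁻¹ z,
            inv_mul_cancel₀ hz, one_smul, smul_sub]
        · rw [pow_succ', Module.End.mul_apply]
          simp only [LinearMap.sub_apply, LinearMap.smul_apply, Module.End.one_apply]
          exact Submodule.sub_mem _ h3 (Submodule.smul_mem _ _ h2)
    rw [(key K).1, hK, smul_zero]

theorem finite_support_series {T : Module.End ℂ V} {v : V} (hv : ∃ K : ℕ, (T ^ K) v = 0)
    (c : ℕ → ℂ) : (Function.support fun k : ℕ => c k • (T ^ k) v).Finite := by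
  obtain ⟨K, hK⟩ := hv
  refine (Set.finite_lt_nat K).subset fun k hk => ?_
  by_contra hlt
  apply hk
  obtain ⟨j, rfl⟩ := Nat.exists_eq_add_of_le' (not_lt.mp hlt)
  simp [pow_add, hK]

/-- The operator `∑ₖ cₖ Tᵏ` for a formal power series `∑ₖ cₖ xᵏ` and a locally nilpotent operator
`T` (each sum is finite on each vector). -/
def seriesOp (T : Module.End ℂ V) (hT : ∀ v, ∃ K : ℕ, (T ^ K) v = 0) (c : PowerSeries ℂ) :
    Module.End ℂ V where
  toFun v := ∑ᶠ k : ℕ, PowerSeries.coeff k c • (T ^ k) v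
  map_add' v w := by
    simp only [map_add, smul_add]
    exact finsum_add_distrib (finite_support_series (hT v) _) (finite_support_series (hT w) _)
  map_smul' a v := by
    simp only [map_smul, RingHom.id_apply]
    rw [smul_finsum' a (finite_support_series (hT v) _)]
    exact finsum_congr fun k => smul_comm _ _ _

/-- The semisimple operator `S`: on the generalized eigenspace of `g` for `z` it is the scalar `α`
with `exp (2πi α) = z` and `0 ≤ Re α < 1`. -/
def semisimplePart (g : Module.End ℂ V) (hg : ⨆ z, g.maxGenEigenspace z = ⊤) :
    Module.End ℂ V :=
  scalarOp g hg exponent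

/-- The locally nilpotent operator `N = (2πi)⁻¹ log (e^{-2πi S} g)`. Here `PowerSeries.log` is the
series of `log (1 + x)`. -/
def nilpotentPart (g : Module.End ℂ V) (hg : ⨆ z, g.maxGenEigenspace z = ⊤)
    (hinj : Function.Injective g) : Module.End ℂ V :=
  (2 * Real.pi * Complex.I : ℂ)⁻¹ •
    seriesOp (unipotentPart g hg - 1) (unipotentPart_locally g hg hinj) (PowerSeries.log ℂ)

theorem seriesOp_eq_sum {T : Module.End ℂ V} (hT : ∀ v, ∃ K : ℕ, (T ^ K) v = 0)
    (c : PowerSeries ℂ) {v : V} {K : ℕ} (hK : (T ^ K) v = 0) :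
    seriesOp T hT c v = ∑ k ∈ Finset.range K, PowerSeries.coeff k c • (T ^ k) v := by
  refine finsum_eq_sum_of_support_subset _ fun k hk => ?_
  by_contra hlt
  apply hk
  simp only [Finset.coe_range, Set.mem_Iio, not_lt] at hlt
  obtain ⟨j, rfl⟩ := Nat.exists_eq_add_of_le' hlt
  simp [pow_add, hK]

theorem seriesOp_mul {T : Module.End ℂ V} (hT : ∀ v, ∃ K : ℕ, (T ^ K) v = 0)
    (c d : PowerSeries ℂ) : seriesOp T hT (c * d) = seriesOp T hT c * seriesOp T hT d := by
  ext v
  obtain ⟨K, hK⟩ := hT v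
  have hz : ∀ n, K ≤ n → (T ^ n) v = 0 := by
    intro n hn
    obtain ⟨j, rfl⟩ := Nat.exists_eq_add_of_le' hn
    simp [pow_add, hK]
  rw [Module.End.mul_apply, seriesOp_eq_sum hT d hK, seriesOp_eq_sum hT (c * d) hK, map_sum]
  have h2 : ∀ k ∈ Finset.range K, seriesOp T hT c (PowerSeries.coeff k d • (T ^ k) v) =
      ∑ l ∈ Finset.range K, (PowerSeries.coeff l c * PowerSeries.coeff k d) • (T ^ (l + k)) v := by
    intro k _
    have : (T ^ K) ((T ^ k) v) = 0 := by
      rw [← Module.End.mul_apply, ← pow_add]; exact hz _ (Nat.le_add_right _ _)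
    rw [map_smul, seriesOp_eq_sum hT c this, Finset.smul_sum]
    refine Finset.sum_congr rfl fun l _ => ?_
    rw [smul_smul, mul_comm, pow_add, Module.End.mul_apply]
  rw [Finset.sum_congr rfl h2, ← Finset.sum_product']
  simp only [PowerSeries.coeff_mul, Finset.sum_smul]
  rw [Finset.sum_sigma']
  symm
  refine Finset.sum_bij_ne_zero (fun p _ _ => ⟨p.2 + p.1, (p.2, p.1)⟩) ?_ ?_ ?_ ?_
  · intro p hp hne
    simp only [Finset.mem_sigma, Finset.mem_range, Finset.HasAntidiagonal.mem_antidiagonal, and_true]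
    by_contra hlt
    exact hne (by rw [hz _ (not_lt.mp hlt), smul_zero])
  · rintro ⟨a, b⟩ _ _ ⟨a', b'⟩ _ _ h
    simp at h
    simp [h.2.1, h.2.2]
  · rintro ⟨n, a, b⟩ h hne
    simp only [Finset.mem_sigma, Finset.mem_range, Finset.HasAntidiagonal.mem_antidiagonal] at h
    obtain ⟨h1, rfl⟩ := h
    refine ⟨(b, a), ?_, ?_, rfl⟩
    · simp only [Finset.mem_product, Finset.mem_range]; omega
    · exact hne
  · intro p _ _; rfl

theorem seriesOp_pow {T : Module.End ℂ V} (hT : ∀ v, ∃ K : ℕ, (T ^ K) v = 0)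
    (c : PowerSeries ℂ) (k : ℕ) : seriesOp T hT (c ^ k) = seriesOp T hT c ^ k := by
  induction k with
  | zero =>
    ext v
    obtain ⟨K, hK⟩ := hT v
    have hK' : (T ^ (K + 1)) v = 0 := by rw [pow_succ', Module.End.mul_apply, hK, map_zero]
    rw [seriesOp_eq_sum hT _ hK', Finset.sum_eq_single 0]
    · simp
    · intro b _ hb; simp [PowerSeries.coeff_one, hb]
    · simp
  | succ k ih => rw [pow_succ, seriesOp_mul, ih, pow_succ]

theorem exp_subst_log :
    (PowerSeries.exp ℂ).subst (PowerSeries.log ℂ) = (1 + PowerSeries.X : PowerSeries ℂ) := by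
  set F : PowerSeries ℂ := (PowerSeries.exp ℂ).subst (PowerSeries.log ℂ) with hF
  have hd : PowerSeries.derivative ℂ F = F * PowerSeries.derivative ℂ (PowerSeries.log ℂ) := by
    rw [hF, PowerSeries.derivative_subst PowerSeries.HasSubst.log, PowerSeries.derivative_exp]
  have hl : PowerSeries.derivative ℂ (PowerSeries.log ℂ) * (1 + PowerSeries.X) = 1 := by
    rw [PowerSeries.deriv_log]
    ext n
    rcases n with _ | n
    · simp [mul_add]
    · simp [mul_add, PowerSeries.coeff_succ_mul_X, pow_succ, PowerSeries.coeff_one]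
  have hF' : PowerSeries.derivative ℂ F * (1 + PowerSeries.X) = F := by
    rw [hd, mul_assoc, hl, mul_one]
  have h0 : PowerSeries.coeff 0 F = 1 := by
    rw [hF, PowerSeries.coeff_subst' PowerSeries.HasSubst.log, finsum_eq_single _ 0]
    · simp
    · intro n hn; simp [hn]
  have hrec : ∀ n : ℕ, PowerSeries.coeff (n + 1) F * (n + 1) + PowerSeries.coeff n F * n =
      PowerSeries.coeff n F := by
    intro n
    have := congrArg (PowerSeries.coeff n) hF'
    rcases n with _ | n
    · have h0' := PowerSeries.coeff_derivative F 0
      simp only [PowerSeries.coeff_zero_eq_constantCoeff_apply, Nat.cast_zero, zero_add,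
        mul_one] at h0'
      simpa [mul_add, h0'] using this
    · simpa [mul_add, PowerSeries.coeff_derivative, PowerSeries.coeff_succ_mul_X] using this
  have h1 : PowerSeries.coeff 1 F = 1 := by simpa [h0] using hrec 0
  have h2 : ∀ n, PowerSeries.coeff (n + 2) F = 0 := by
    intro n
    induction n with
    | zero =>
      have := hrec 1
      rw [h1] at this
      norm_num at this
      simpa using this
    | succ n ih =>
      have := hrec (n + 2)
      rw [ih, zero_mul, add_zero] at this
      refine (mul_eq_zero.mp this).resolve_right ?_
      exact_mod_cast Nat.succ_ne_zero (n + 2)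
  ext n
  rcases n with _ | _ | n
  · rw [h0]; simp
  · rw [h1]; simp
  · rw [h2]; simp [PowerSeries.coeff_one, PowerSeries.coeff_X]

theorem exp_log_series {T : Module.End ℂ V} (hT : ∀ v, ∃ K : ℕ, (T ^ K) v = 0) (v : V) :
    ∑ᶠ k : ℕ, ((k.factorial : ℂ)⁻¹) • ((seriesOp T hT (PowerSeries.log ℂ)) ^ k) v = v + T v := by
  obtain ⟨K, hK⟩ := hT v
  have hK2 : (T ^ (K + 2)) v = 0 := by rw [add_comm, pow_add, Module.End.mul_apply, hK, map_zero]
  have hc : ∀ n k : ℕ, n < k → PowerSeries.coeff n ((PowerSeries.log ℂ) ^ k) = 0 := by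
    intro n k h
    refine PowerSeries.coeff_of_lt_order _ (lt_of_lt_of_le (Nat.cast_lt.mpr h) ?_)
    exact PowerSeries.le_order_pow_of_constantCoeff_eq_zero k PowerSeries.constantCoeff_log
  have hk : ∀ k : ℕ, ((k.factorial : ℂ)⁻¹) • ((seriesOp T hT (PowerSeries.log ℂ)) ^ k) v =
      ∑ n ∈ Finset.range (K + 2), ((k.factorial : ℂ)⁻¹ *
        PowerSeries.coeff n ((PowerSeries.log ℂ) ^ k)) • (T ^ n) v := by
    intro k
    rw [← seriesOp_pow, seriesOp_eq_sum hT _ hK2, Finset.smul_sum]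
    simp only [smul_smul]
  simp only [hk]
  rw [finsum_eq_sum_of_support_subset (s := Finset.range (K + 2)), Finset.sum_comm]
  · have hn : ∀ n ∈ Finset.range (K + 2), ∑ k ∈ Finset.range (K + 2), ((k.factorial : ℂ)⁻¹ *
        PowerSeries.coeff n ((PowerSeries.log ℂ) ^ k)) • (T ^ n) v =
        PowerSeries.coeff n (1 + PowerSeries.X : PowerSeries ℂ) • (T ^ n) v := by
      intro n hn
      rw [← Finset.sum_smul, ← exp_subst_log, PowerSeries.coeff_subst' PowerSeries.HasSubst.log,
        finsum_eq_sum_of_support_subset (s := Finset.range (K + 2))]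
      · simp
      · intro k hk
        by_contra hlt
        simp only [Finset.coe_range, Set.mem_Iio, not_lt] at hlt
        exact hk (by
          dsimp only
          rw [hc n k (lt_of_lt_of_le (Finset.mem_range.mp hn) hlt), smul_zero])
    rw [Finset.sum_congr rfl hn, Finset.sum_range_succ', Finset.sum_range_succ',
      Finset.sum_eq_zero]
    · simp [add_comm]
    · intro n _
      simp [PowerSeries.coeff_one, PowerSeries.coeff_X]
  · intro k hk
    by_contra hlt
    simp only [Finset.coe_range, Set.mem_Iio, not_lt] at hlt
    refine hk (Finset.sum_eq_zero fun n hn => ?_)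
    rw [hc n k (lt_of_lt_of_le (Finset.mem_range.mp hn) hlt), mul_zero, zero_smul]

/-- `g = e^{2πi S} e^{2πi N}`. -/
theorem eq_exp_mul_exp (g : Module.End ℂ V) (hg : ⨆ z, g.maxGenEigenspace z = ⊤)
    (hinj : Function.Injective g) (v : V) :
    g v = scalarOp g hg (fun z => Complex.exp (2 * Real.pi * Complex.I * exponent z))
      (∑ᶠ k : ℕ, ((2 * Real.pi * Complex.I) ^ k / (k.factorial : ℂ)) •
        ((nilpotentPart g hg hinj) ^ k) v) := by
  have h : (2 * Real.pi * Complex.I : ℂ) ≠ 0 := Complex.two_pi_I_ne_zero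
  have h1 : ∀ k : ℕ, ((2 * Real.pi * Complex.I) ^ k / (k.factorial : ℂ)) •
      ((nilpotentPart g hg hinj) ^ k) v = ((k.factorial : ℂ)⁻¹) •
      ((seriesOp (unipotentPart g hg - 1) (unipotentPart_locally g hg hinj)
        (PowerSeries.log ℂ)) ^ k) v := by
    intro k
    rw [nilpotentPart, smul_pow, LinearMap.smul_apply, smul_smul]
    congr 1
    rw [inv_pow]
    field_simp
  rw [finsum_congr h1, exp_log_series]
  have hv : v ∈ ⨆ z, g.maxGenEigenspace z := hg ▸ Submodule.mem_top
  simp only [LinearMap.sub_apply, Module.End.one_apply, add_sub_cancel]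
  refine Submodule.iSup_induction _ (motive := fun v => g v = scalarOp g hg
    (fun z => Complex.exp (2 * Real.pi * Complex.I * exponent z)) (unipotentPart g hg v)) hv ?_ ?_ ?_
  · intro z w hw
    have hgw : g w ∈ g.maxGenEigenspace z :=
      Module.End.mapsTo_maxGenEigenspace_of_comm (Commute.refl g) z hw
    rw [unipotentPart, Module.End.mul_apply, scalarOp_apply g hg _ hgw, map_smul,
      scalarOp_apply g hg _ hgw, smul_smul]
    rcases eq_or_ne z 0 with rfl | hz
    · obtain ⟨K, hK⟩ := (Module.End.mem_maxGenEigenspace g 0 w).mp hw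
      have hi : Function.Injective (g ^ K) := by
        rw [Module.End.coe_pow]; exact hinj.iterate K
      have : w = 0 := hi (by simpa using hK)
      simp [this]
    · rw [exp_exponent hz, inv_mul_cancel₀ hz, one_smul]
  · simp
  · intro a b ha hb
    rw [map_add, map_add, map_add, ha, hb]

end OperatorLog

/-! ### Vertex operator algebras -/

/-- A vertex operator algebra structure `(V, Y, 𝟏, ω)` over `ℂ`. A `VertexOperator ℂ V` is a linear
map from `V` to `V((x))`, so the lower truncation property is built in; `ncoeff (Y u) n` is the mode
`u(n)`, the coefficient of `x^(-n-1)` in `Y(u, x)`. -/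
structure VertexOperatorAlgebra (V : Type*) [AddCommGroup V] [Module ℂ V] where
  /-- the weight space `V_(n)` -/
  grade : ℤ → Submodule ℂ V
  isInternal_grade : DirectSum.IsInternal grade
  finiteDimensional_grade : ∀ n, FiniteDimensional ℂ (grade n)
  exists_grade_eq_bot : ∃ n₀ : ℤ, ∀ n < n₀, grade n = ⊥
  /-- the vertex operator map `u ↦ Y(u, x)` -/
  Y : V →ₗ[ℂ] VertexOperator ℂ V
  /-- the vacuum vector -/
  one : V
  /-- the conformal vector -/
  omega : V
  one_mem : one ∈ grade 0
  omega_mem : omega ∈ grade 2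
  vacuum : ∀ n : ℤ, ncoeff (Y one) n = if n = -1 then 1 else 0
  creation : ∀ u : V, ncoeff (Y u) (-1) one = u
  creation_regular : ∀ (u : V) (n : ℤ), 0 ≤ n → ncoeff (Y u) n one = 0
  /-- The Jacobi identity: the coefficient of `x₀^(-s-1) x₁^(-r-1) x₂^(-t-1)` in
  `x₀⁻¹ δ((x₁ - x₂)/x₀) Y(u,x₁) Y(v,x₂) w - x₀⁻¹ δ((-x₂ + x₁)/x₀) Y(v,x₂) Y(u,x₁) w
    = x₁⁻¹ δ((x₂ + x₀)/x₁) Y(Y(u,x₀)v,x₂) w`. -/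
  jacobi : ∀ (u v w : V) (s r t : ℤ),
    (∑ᶠ i : ℕ, ((-1) ^ i * Ring.choose s i : ℤ) •
        ncoeff (Y u) (r + s - i) (ncoeff (Y v) (t + i) w))
      - (∑ᶠ i : ℕ, (((s - i).negOnePow : ℤ) * Ring.choose s i) •
          ncoeff (Y v) (t + s - i) (ncoeff (Y u) (r + i) w))
      = ∑ᶠ i : ℕ, (Ring.choose r i : ℤ) • ncoeff (Y (ncoeff (Y u) (s + i) v)) (r + t - i) w
  /-- the central charge -/
  centralCharge : ℂ
  /-- The modes `L(n) = ω(n+1)` satisfy the Virasoro relations. -/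
  virasoro : ∀ m n : ℤ,
    ncoeff (Y omega) (m + 1) * ncoeff (Y omega) (n + 1)
        - ncoeff (Y omega) (n + 1) * ncoeff (Y omega) (m + 1)
      = ((m : ℂ) - n) • ncoeff (Y omega) (m + n + 1)
        + (if m + n = 0 then ((m : ℂ) ^ 3 - m) / 12 * centralCharge else 0) •
          (1 : Module.End ℂ V)
  /-- `L(0)` acts on `V_(n)` as the scalar `n`. -/
  L_zero : ∀ (n : ℤ), ∀ v ∈ grade n, ncoeff (Y omega) 1 v = (n : ℂ) • v
  /-- the `L(-1)`-derivative property `Y(L(-1)u, x) = d/dx Y(u, x)` -/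
  L_neg_one : ∀ (u : V) (n : ℤ), ncoeff (Y (ncoeff (Y omega) 0 u)) n = (-(n : ℂ)) • ncoeff (Y u) (n - 1)

namespace VertexOperatorAlgebra

variable {V : Type*} [AddCommGroup V] [Module ℂ V] (A : VertexOperatorAlgebra V)

/-- `V₊`, the span of the vectors of positive weight. -/
def positivePart : Submodule ℂ V := ⨆ (n : ℤ) (_ : 0 < n), A.grade n

/-- CFT type: no negative weights, and `V_(0) = ℂ𝟏`. -/
def IsCFTType : Prop :=
  (∀ n < 0, A.grade n = ⊥) ∧ A.grade 0 = Submodule.span ℂ {A.one}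

/-- Automorphisms of a vertex operator algebra. -/
structure Automorphism where
  toLinearEquiv : V ≃ₗ[ℂ] V
  map_one : toLinearEquiv A.one = A.one
  map_omega : toLinearEquiv A.omega = A.omega
  map_mode : ∀ (u v : V) (n : ℤ),
    toLinearEquiv (ncoeff (A.Y u) n v) = ncoeff (A.Y (toLinearEquiv u)) n (toLinearEquiv v)

theorem grade_eq_eigenspace (n : ℤ) :
    A.grade n = Module.End.eigenspace (ncoeff (A.Y A.omega) 1) (n : ℂ) := by
  have hle : ∀ m, A.grade m ≤ Module.End.eigenspace (ncoeff (A.Y A.omega) 1) (m : ℂ) :=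
    fun m v hv => Module.End.mem_eigenspace_iff.mpr (A.L_zero m v hv)
  refine le_antisymm (hle n) fun v hv => ?_
  have hind : iSupIndep fun m : ℤ => Module.End.eigenspace (ncoeff (A.Y A.omega) 1) (m : ℂ) :=
    (Module.End.eigenspaces_iSupIndep _).comp Int.cast_injective
  have htop : ⨆ m, A.grade m = ⊤ := A.isInternal_grade.submodule_iSup_eq_top
  have hv' : v ∈ A.grade n ⊔ ⨆ (m : ℤ) (_ : m ≠ n), A.grade m := by
    have : (⊤ : Submodule ℂ V) ≤ A.grade n ⊔ ⨆ (m : ℤ) (_ : m ≠ n), A.grade m := by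
      rw [← htop]
      refine iSup_le fun m => ?_
      rcases eq_or_ne m n with rfl | h
      · exact le_sup_left
      · exact le_sup_of_le_right (le_iSup₂_of_le m h le_rfl)
    exact this Submodule.mem_top
  obtain ⟨a, ha, b, hb, rfl⟩ := Submodule.mem_sup.mp hv'
  have hb' : b ∈ ⨆ (m : ℤ) (_ : m ≠ n),
      Module.End.eigenspace (ncoeff (A.Y A.omega) 1) (m : ℂ) :=
    (iSup₂_mono fun m _ => hle m : _ ≤ _) hb
  have hbn : b ∈ Module.End.eigenspace (ncoeff (A.Y A.omega) 1) (n : ℂ) := by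
    simpa using Submodule.sub_mem _ hv (hle n ha)
  have : b = 0 := Submodule.disjoint_def.mp (hind n) b hbn hb'
  simpa [this] using ha

namespace Automorphism

variable {A} (g : A.Automorphism)

/-- An automorphism as an endomorphism. -/
def toEnd : Module.End ℂ V := g.toLinearEquiv.toLinearMap

theorem toEnd_injective : Function.Injective g.toEnd := g.toLinearEquiv.injective

theorem iSup_maxGenEigenspace : ⨆ z, g.toEnd.maxGenEigenspace z = ⊤ := by
  rw [eq_top_iff, ← A.isInternal_grade.submodule_iSup_eq_top]
  refine iSup_le fun n => ?_
  have hmaps : ∀ x ∈ A.grade n, g.toEnd x ∈ A.grade n := by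
    intro x hx
    rw [A.grade_eq_eigenspace, Module.End.mem_eigenspace_iff] at hx ⊢
    have := g.map_mode A.omega x 1
    rw [hx, g.map_omega, map_smul] at this
    exact this.symm
  have := A.finiteDimensional_grade n
  have htop := Module.End.iSup_maxGenEigenspace_eq_top (g.toEnd.restrict hmaps)
  calc A.grade n
      = ⨆ z, (Module.End.maxGenEigenspace (g.toEnd.restrict hmaps) z).map (A.grade n).subtype := by
        rw [← Submodule.map_iSup, htop, Submodule.map_subtype_top]
    _ ≤ _ := by
        refine iSup_mono fun z => ?_
        rw [Module.End.maxGenEigenspace, Module.End.genEigenspace_restrict]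
        exact Submodule.map_comap_le _ _

/-- The semisimple operator `S` on `V`. -/
def S : Module.End ℂ V := OperatorLog.semisimplePart g.toEnd g.iSup_maxGenEigenspace

/-- The locally nilpotent operator `N` on `V`. -/
def N : Module.End ℂ V :=
  OperatorLog.nilpotentPart g.toEnd g.iSup_maxGenEigenspace g.toEnd_injective

/-- The operator `L = S + N`, with `g = e^{2πi L}` (see `OperatorLog.eq_exp_mul_exp`). -/
def L : Module.End ℂ V := g.S + g.N

/-- `P(V)`, the set of eigenvalues of `S`. -/
def spectrumS : Set ℂ := {α | g.S.HasEigenvalue α}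

/-- `V^{[α]} = {v : S v = α v}`. -/
def sector (α : ℂ) : Submodule ℂ V := g.S.eigenspace α

/-- The operator `binom(L, j) = L (L - 1) ⋯ (L - j + 1) / j!`. -/
def chooseL (j : ℕ) : Module.End ℂ V :=
  ((j.factorial : ℂ)⁻¹) • Polynomial.aeval g.L (descPochhammer ℂ j)

end Automorphism

end VertexOperatorAlgebra

/-! ### Weak twisted modules -/

/-- The space `(End W){x}[log x]`: polynomials in `log x` whose coefficients are formal series in
arbitrary complex powers of `x`. The value `f k e` is the coefficient of `x^e (log x)^k`. -/
abbrev LogSeries (W : Type*) [AddCommGroup W] [Module ℂ W] : Type _ :=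
  ℕ →₀ (ℂ → Module.End ℂ W)

namespace LogSeries

variable {W : Type*} [AddCommGroup W] [Module ℂ W]

/-- `a(n, k)`, the coefficient of `x^(-n-1) (log x)^k`. -/
def mode (f : LogSeries W) (n : ℂ) (k : ℕ) : Module.End ℂ W := f k (-n - 1)

/-- `e^{2πi x d/dx}`: replaces `x^e (log x)^k` by `e^{2πi e} x^e (log x + 2πi)^k`. -/
def monodromy (f : LogSeries W) : LogSeries W :=
  f.sum fun k a => ∑ j ∈ Finset.range (k + 1), Finsupp.single j fun e : ℂ =>
    (Complex.exp (2 * Real.pi * Complex.I * e) * (k.choose j : ℂ) *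
      (2 * Real.pi * Complex.I) ^ (k - j)) • a e

end LogSeries

open VertexOperatorAlgebra in
/-- Weak `g`-twisted modules for a vertex operator algebra.

The Jacobi identity is
`x₀⁻¹ δ((x₁ - x₂)/x₀) Y_W(u,x₁) Y_W(v,x₂) - x₀⁻¹ δ((-x₂ + x₁)/x₀) Y_W(v,x₂) Y_W(u,x₁)
  = x₁⁻¹ δ((x₂ + x₀)/x₁) Y_W(Y(((x₂ + x₀)/x₁)^L u, x₀) v, x₂)`.
It is linear in `u`, and `V` is the direct sum of the `V^{[α]}`, so it is imposed for
`u ∈ V^{[α]}`. For such `u`,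
`((x₂ + x₀)/x₁)^L u
  = ∑_{j,p,q} (-1)^p/(p! q!) x₀^j x₁^(-α) x₂^(α-j) (log x₁)^p (log x₂)^q N^(p+q) binom(L,j) u`,
as `((x₂ + x₀)/x₁)^L = (x₂/x₁)^S e^{(log x₂ - log x₁) N} (1 + x₀/x₂)^L`, and
`x₁⁻¹ δ((x₂ + x₀)/x₁) = ∑_{m ∈ ℤ} ∑_i binom(m,i) x₀^i x₁^(-m-1) x₂^(m-i)`.
The fields `jacobi` and `jacobi_off` compare, on each `w`, the coefficients of
`x₀^(-s-1) x₁^(-r-1) x₂^(-t-1) (log x₁)^a (log x₂)^b`, for `r = α + m` with `m ∈ ℤ` and for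
`r ∉ α + ℤ` (where the right-hand side has none). -/
structure WeakTwistedModule {V : Type*} [AddCommGroup V] [Module ℂ V]
    (A : VertexOperatorAlgebra V) (g : A.Automorphism)
    (W : Type*) [AddCommGroup W] [Module ℂ W] where
  /-- the twisted vertex operator map `u ↦ Y_W(u, x)` -/
  Y : V →ₗ[ℂ] LogSeries W
  truncation : ∀ (u : V) (w : W) (n : ℂ) (k : ℕ),
    ∃ l₀ : ℤ, ∀ l : ℤ, l₀ ≤ l → (Y u).mode (n + l) k w = 0
  identity : Y A.one = Finsupp.single 0 fun e => if e = 0 then 1 else 0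
  jacobi : ∀ (α : ℂ), ∀ u ∈ g.sector α, ∀ (v : V) (w : W) (s m : ℤ) (t : ℂ) (a b : ℕ),
    (∑ᶠ i : ℕ, ((-1) ^ i * Ring.choose s i : ℤ) •
        (Y u).mode (α + m + s - i) a ((Y v).mode (t + i) b w))
      - (∑ᶠ i : ℕ, (((s - i).negOnePow : ℤ) * Ring.choose s i) •
        (Y v).mode (t + s - i) b ((Y u).mode (α + m + i) a w))
      = ∑ᶠ d : ℕ, ∑ ij ∈ Finset.HasAntidiagonal.antidiagonal d, ∑ q ∈ Finset.range (b + 1),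
        (((Ring.choose m ij.1 : ℤ) : ℂ) * ((-1) ^ a / ((a.factorial : ℂ) * (q.factorial : ℂ)))) •
          (Y (ncoeff (A.Y ((g.N ^ (a + q)) (g.chooseL ij.2 u))) (s + d) v)).mode
            (α + m + t - d) (b - q) w
  jacobi_off : ∀ (α : ℂ), ∀ u ∈ g.sector α, ∀ (v : V) (w : W) (s : ℤ) (r t : ℂ) (a b : ℕ),
    (∀ m : ℤ, r ≠ α + m) →
    (∑ᶠ i : ℕ, ((-1) ^ i * Ring.choose s i : ℤ) •
        (Y u).mode (r + s - i) a ((Y v).mode (t + i) b w))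
      - (∑ᶠ i : ℕ, (((s - i).negOnePow : ℤ) * Ring.choose s i) •
        (Y v).mode (t + s - i) b ((Y u).mode (r + i) a w)) = 0
  equivariance : ∀ u : V, (Y (g.toLinearEquiv u)).monodromy = Y u

namespace WeakTwistedModule

variable {V : Type*} [AddCommGroup V] [Module ℂ V] {A : VertexOperatorAlgebra V}
  {g : A.Automorphism} {W : Type*} [AddCommGroup W] [Module ℂ W]

/-- The subspace `C_n(W)`, for `n ≥ 1`, spanned by the `u(α - n, 0) w` with `u ∈ V^{[α]}`,
`α ∈ P(V)`, `w ∈ W`, and `u ∈ V₊` if `n = 1`. -/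
def C (M : WeakTwistedModule A g W) (n : ℕ) : Submodule ℂ W :=
  Submodule.span ℂ {x | ∃ α ∈ g.spectrumS, ∃ u ∈ g.sector α, ∃ w : W,
    (n = 1 → u ∈ A.positivePart) ∧ x = (M.Y u).mode (α - n) 0 w}

/-- `C_n`-cofiniteness: `dim W / C_n(W) < ∞`. -/
def IsCofinite (M : WeakTwistedModule A g W) (n : ℕ) : Prop :=
  FiniteDimensional ℂ (W ⧸ M.C n)

end WeakTwistedModule

end

open VertexOperator (ncoeff)

/-! ### Commutation, local nilpotency and spectrum of the parts of the logarithm of `g` -/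

namespace OperatorLog

variable {V : Type*} [AddCommGroup V] [Module ℂ V]

/-! The inclusion `C_{n+1} ⊆ C_n` comes from the `L(-1)`-derivative property. For `u ∈ V^{[α]}`,
taking the vacuum as second vector in the twisted Jacobi identity gives (`mode_translation`)
`(L(-1)u)(α - n, 0) = -(α - n) u(α - n - 1, 0) - (N u)(α - n - 1, 0)`. The left side lies in `C_n`,
because `L(-1)` commutes with `S` and so preserves `V^{[α]}`. The scalar `α - n` is nonzero, because
`Re α < 1 ≤ n`. Hence `u(α - n - 1, 0) w` lies in `C_n` as soon as `(N u)(α - n - 1, 0) w` does.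
Since `N` preserves `V^{[α]}` and is locally nilpotent, an induction on the power of `N` that kills
`u` finishes the argument (`C_succ_le`).

For `n = 1` one also needs `L(-1)u ∈ V₊`. This holds in CFT type: `L(-1)` raises weight by one and
kills the vacuum, which spans weight zero. Cofiniteness passes to the larger subspace because the
quotient gets smaller. -/

theorem commute_scalarOp {g B : Module.End ℂ V} (hg : ⨆ z, g.maxGenEigenspace z = ⊤)
    (hB : Commute g B) (c : ℂ → ℂ) : Commute (scalarOp g hg c) B := by
  refine LinearMap.ext fun v => ?_
  have hv : v ∈ ⨆ z, g.maxGenEigenspace z := hg ▸ Submodule.mem_top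
  refine Submodule.iSup_induction _ (motive := fun v => (scalarOp g hg c * B) v =
    (B * scalarOp g hg c) v) hv ?_ (by simp) fun a b ha hb => by rw [map_add, map_add, ha, hb]
  intro z w hw
  have hBw : B w ∈ g.maxGenEigenspace z :=
    Module.End.mapsTo_maxGenEigenspace_of_comm hB z hw
  rw [Module.End.mul_apply, Module.End.mul_apply, scalarOp_apply g hg c hw,
    scalarOp_apply g hg c hBw, map_smul]

theorem commute_seriesOp {T B : Module.End ℂ V} (hT : ∀ v, ∃ K : ℕ, (T ^ K) v = 0)
    (hB : Commute T B) (c : PowerSeries ℂ) : Commute (seriesOp T hT c) B := by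
  refine LinearMap.ext fun v => ?_
  have hk : ∀ k : ℕ, (T ^ k) (B v) = B ((T ^ k) v) := fun k =>
    LinearMap.congr_fun (hB.pow_left k).eq v
  obtain ⟨K, hK⟩ := hT v
  have hK' : (T ^ K) (B v) = 0 := by rw [hk, hK, map_zero]
  rw [Module.End.mul_apply, Module.End.mul_apply, seriesOp_eq_sum hT c hK,
    seriesOp_eq_sum hT c hK', map_sum]
  exact Finset.sum_congr rfl fun k _ => by rw [hk, map_smul]

/-- The series `c ^ K` has order at least `K`, so `c(T)^K` involves only powers `T ^ n` with `n ≥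
K`. The exponent that kills `v` for `T` therefore also works for `c(T)`. -/
theorem seriesOp_locally_nilpotent {T : Module.End ℂ V} (hT : ∀ v, ∃ K : ℕ, (T ^ K) v = 0)
    {c : PowerSeries ℂ} (hc : PowerSeries.constantCoeff c = 0) (v : V) :
    ∃ K : ℕ, (seriesOp T hT c ^ K) v = 0 := by
  obtain ⟨K, hK⟩ := hT v
  refine ⟨K, ?_⟩
  rw [← seriesOp_pow, seriesOp_eq_sum hT _ hK]
  refine Finset.sum_eq_zero fun n hn => ?_
  rw [PowerSeries.coeff_of_lt_order n (lt_of_lt_of_le (Nat.cast_lt.mpr (Finset.mem_range.mp hn))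
    (PowerSeries.le_order_pow_of_constantCoeff_eq_zero K hc)), zero_smul]

/-- Whatever commutes with `g` commutes with the scalar operators on its generalized eigenspaces,
hence with the unipotent part and with any series in it. `S` itself commutes with `g`. -/
theorem commute_semisimplePart_nilpotentPart (g : Module.End ℂ V)
    (hg : ⨆ z, g.maxGenEigenspace z = ⊤) (hinj : Function.Injective g) :
    Commute (semisimplePart g hg) (nilpotentPart g hg hinj) := by
  have hgS : Commute g (semisimplePart g hg) :=
    (commute_scalarOp hg (Commute.refl g) exponent).symm
  have hT : Commute (unipotentPart g hg - 1) (semisimplePart g hg) :=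
    ((commute_scalarOp hg hgS _).mul_left hgS).sub_left (Commute.one_left _)
  exact (Commute.smul_left (commute_seriesOp _ hT _) _).symm

theorem nilpotentPart_locally_nilpotent (g : Module.End ℂ V)
    (hg : ⨆ z, g.maxGenEigenspace z = ⊤) (hinj : Function.Injective g) (v : V) :
    ∃ K : ℕ, (nilpotentPart g hg hinj ^ K) v = 0 := by
  obtain ⟨K, hK⟩ := seriesOp_locally_nilpotent (unipotentPart_locally g hg hinj)
    PowerSeries.constantCoeff_log v
  exact ⟨K, by rw [nilpotentPart, smul_pow, LinearMap.smul_apply, hK, smul_zero]⟩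

/-- The generalized eigenspaces of `g` span `V`, and each lies in an eigenspace of `S` for some
`exponent z`. Were `α` not of this form, independence of eigenspaces would make its eigenspace
disjoint from all of `V`, hence zero. -/
theorem exists_exponent_eq_of_hasEigenvalue (g : Module.End ℂ V)
    (hg : ⨆ z, g.maxGenEigenspace z = ⊤) {α : ℂ}
    (hα : (semisimplePart g hg).HasEigenvalue α) : ∃ z, exponent z = α := by
  by_contra! h
  refine hα (disjoint_top.mp (?_ : Disjoint _ ⊤))
  rw [← hg]
  refine ((semisimplePart g hg).eigenspaces_iSupIndep α).mono_right (iSup_le fun z v hv => ?_)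
  refine Submodule.mem_iSup_of_mem (exponent z) (Submodule.mem_iSup_of_mem (h z) ?_)
  exact Module.End.mem_eigenspace_iff.mpr (scalarOp_apply g hg exponent hv)

end OperatorLog

/-! ### The translation operator `L(-1)`, and the interplay of `S`, `N` and `L(-1)` -/

namespace VertexOperatorAlgebra

variable {V : Type*} [AddCommGroup V] [Module ℂ V] (A : VertexOperatorAlgebra V)

/-- The translation operator `L(-1)`. -/
def translation : Module.End ℂ V := ncoeff (A.Y A.omega) 0

/-- The derivative property for the mode `-1`, applied to the vacuum and combined with the creation
property. -/
theorem ncoeff_neg_two_one (u : V) : ncoeff (A.Y u) (-2) A.one = A.translation u := by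
  have h := LinearMap.congr_fun (A.L_neg_one u (-1)) A.one
  rw [A.creation] at h
  simpa [translation] using h.symm

theorem translation_one : A.translation A.one = 0 := by
  rw [← A.ncoeff_neg_two_one, A.vacuum]
  simp

/-- The Virasoro relation `[L(0), L(-1)] = L(-1)`, whose central term vanishes, raises the
`L(0)`-eigenvalue by one. Eigenspaces of `L(0)` for integers are the weight spaces. -/
theorem translation_mem_grade {n : ℤ} {v : V} (hv : v ∈ A.grade n) :
    A.translation v ∈ A.grade (n + 1) := by
  have h := LinearMap.congr_fun (A.virasoro 0 (-1)) v
  have h0 := A.L_zero n v hv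
  simp only [zero_add, LinearMap.sub_apply, Module.End.mul_apply, neg_add_cancel, h0,
    map_smul] at h
  rw [A.grade_eq_eigenspace, Module.End.mem_eigenspace_iff]
  have h' : ncoeff (A.Y A.omega) 1 (A.translation v) - (n : ℂ) • A.translation v =
      A.translation v := by
    simpa [translation] using h
  rw [sub_eq_iff_eq_add.mp h']
  push_cast
  rw [add_smul, one_smul, add_comm]

variable {A} in
-- Only weight zero could cause trouble, since there positivity of the source fails; but it is
-- spanned by the vacuum, which `L(-1)` kills.
theorem IsCFTType.translation_mem_positivePart (hA : A.IsCFTType) (v : V) :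
    A.translation v ∈ A.positivePart := by
  suffices h : ⨆ n, A.grade n ≤ A.positivePart.comap A.translation from
    h (A.isInternal_grade.submodule_iSup_eq_top ▸ Submodule.mem_top)
  refine iSup_le fun n v hv => ?_
  rw [Submodule.mem_comap]
  rcases lt_trichotomy n 0 with hn | rfl | hn
  · rw [hA.1 n hn, Submodule.mem_bot] at hv
    simp [hv]
  · rw [hA.2] at hv
    obtain ⟨c, rfl⟩ := Submodule.mem_span_singleton.mp hv
    simp [translation_one]
  · exact Submodule.mem_iSup_of_mem (n + 1)
      (Submodule.mem_iSup_of_mem (by omega) (A.translation_mem_grade hv))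

namespace Automorphism

variable {A} (g : A.Automorphism)

/-- An automorphism fixes `ω`, so it commutes with `L(-1) = ω(0)`; `S` is built from the generalized
eigenspaces of `g`. -/
theorem commute_S_translation : Commute g.S A.translation := by
  refine OperatorLog.commute_scalarOp g.iSup_maxGenEigenspace (LinearMap.ext fun v => ?_) _
  have h := g.map_mode A.omega v 0
  rwa [g.map_omega] at h

theorem commute_S_N : Commute g.S g.N :=
  OperatorLog.commute_semisimplePart_nilpotentPart _ _ _

theorem N_locally_nilpotent (v : V) : ∃ K : ℕ, (g.N ^ K) v = 0 :=
  OperatorLog.nilpotentPart_locally_nilpotent _ _ _ v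

variable {g} in
theorem re_lt_one_of_mem_spectrumS {α : ℂ} (hα : α ∈ g.spectrumS) : α.re < 1 := by
  obtain ⟨z, rfl⟩ := OperatorLog.exists_exponent_eq_of_hasEigenvalue _ _ hα
  exact OperatorLog.exponent_re_lt_one z

variable {g} in
theorem mem_sector_of_commute {B : Module.End ℂ V} (hB : Commute g.S B) {α : ℂ} {u : V}
    (hu : u ∈ g.sector α) : B u ∈ g.sector α := by
  have h := LinearMap.congr_fun hB.eq u
  rw [sector, Module.End.mem_eigenspace_iff] at hu ⊢
  rwa [Module.End.mul_apply, Module.End.mul_apply, hu, map_smul] at h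

theorem chooseL_zero : g.chooseL 0 = 1 := by simp [chooseL]

theorem chooseL_one : g.chooseL 1 = g.L := by simp [chooseL]

end Automorphism

end VertexOperatorAlgebra

theorem LogSeries.mode_smul {W : Type*} [AddCommGroup W] [Module ℂ W] (c : ℂ) (f : LogSeries W)
    (n : ℂ) (k : ℕ) : (c • f).mode n k = c • f.mode n k := rfl

theorem LogSeries.mode_add {W : Type*} [AddCommGroup W] [Module ℂ W] (f f' : LogSeries W)
    (n : ℂ) (k : ℕ) : (f + f').mode n k = f.mode n k + f'.mode n k := rfl

theorem LogSeries.mode_zero {W : Type*} [AddCommGroup W] [Module ℂ W]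
    (n : ℂ) (k : ℕ) : (0 : LogSeries W).mode n k = 0 := rfl

/-! ### The derivative property on twisted modules and the inclusions between the `C_n` -/

namespace WeakTwistedModule

variable {V : Type*} [AddCommGroup V] [Module ℂ V] {A : VertexOperatorAlgebra V}
  {g : A.Automorphism} {W : Type*} [AddCommGroup W] [Module ℂ W]

theorem mode_one (M : WeakTwistedModule A g W) (n : ℂ) :
    (M.Y A.one).mode n 0 = if n = -1 then 1 else 0 := by
  have h : -n - 1 = 0 ↔ n = -1 :=
    ⟨fun h => by linear_combination -h, fun h => by rw [h]; ring⟩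
  simp [LogSeries.mode, M.identity, h]

/-- The `L(-1)`-derivative property for the modes without logarithm, in the form
`(L(-1)u)(n, 0) = -((n + N)u)(n - 1, 0)` for `n ∈ α + ℤ`. -/
theorem mode_translation (M : WeakTwistedModule A g W) {α : ℂ} {u : V} (hu : u ∈ g.sector α)
    (m : ℤ) (w : W) :
    (M.Y (A.translation u)).mode (α + m) 0 w =
      -(α + m) • (M.Y u).mode (α + m - 1) 0 w - (M.Y (g.N u)).mode (α + m - 1) 0 w := by
  -- With `s = -2` the right side starts at `u(-2)𝟏 = L(-1)u`. With `t = -1` the first sum retains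
  -- only its `i = 0` term, where the vacuum acts as the identity. The shift to `m + 1` makes
  -- `L(-1)u` appear at mode `α + m`. Taking both logarithmic degrees zero leaves no power of `N`
  -- outside `binom(L, j)`.
  have h := M.jacobi α u hu A.one w (-2) (m + 1) (-1) 0 0
  have hfirst : ∀ i : ℕ, i ≠ 0 → (M.Y A.one).mode (-1 + i) 0 w = 0 := by
    intro i hi
    simp [mode_one, hi]
  -- The second sum involves only the modes `-3 - i` of the vacuum, all different from `-1`.
  have hsecond : ∀ i : ℕ, (M.Y A.one).mode (-1 + ((-2 : ℤ) : ℂ) - i) 0 = 0 := by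
    intro i
    rw [mode_one, if_neg]
    intro h
    have h' : ((i + 2 : ℕ) : ℂ) = 0 := by push_cast at h ⊢; linear_combination -h
    exact absurd (Nat.cast_eq_zero.mp h') (by omega)
  rw [finsum_eq_single _ 0 fun i hi => by rw [hfirst i hi, map_zero, smul_zero],
    finsum_eq_zero_of_forall_eq_zero fun i => by
      rw [hsecond, LinearMap.zero_apply, smul_zero],
    finsum_eq_sum_of_support_subset (s := Finset.range 2)] at h
  · have hLu : g.L u = α • u + g.N u := by
      rw [VertexOperatorAlgebra.Automorphism.L, LinearMap.add_apply,
        Module.End.mem_eigenspace_iff.mp hu]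
    have e1 : α + ((m : ℂ) + 1) + -2 = α + m - 1 := by ring
    have e3 : α + ((m : ℂ) + 1) + -1 = α + m := by ring
    simp [Finset.sum_range_succ, Finset.Nat.antidiagonal_succ, mode_one,
      VertexOperatorAlgebra.Automorphism.chooseL_zero,
      VertexOperatorAlgebra.Automorphism.chooseL_one, A.ncoeff_neg_two_one, A.creation, hLu,
      LogSeries.mode_add, LogSeries.mode_smul, e1, e3] at h
    generalize (M.Y u).mode (α + m - 1) 0 w = x at h ⊢
    generalize (M.Y (g.N u)).mode (α + m - 1) 0 w = y at h ⊢
    generalize (M.Y (A.translation u)).mode (α + m) 0 w = z at h ⊢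
    linear_combination (norm := module) -h
  -- For `d ≥ 2` the mode `-2 + d` is nonnegative and annihilates the vacuum, so only `d = 0` and `d
  -- = 1` contribute.
  · intro d hd
    by_contra hlt
    simp only [Finset.coe_range, Set.mem_Iio, not_lt] at hlt
    refine hd (Finset.sum_eq_zero fun ij _ => Finset.sum_eq_zero fun q _ => ?_)
    rw [A.creation_regular _ _ (by omega), map_zero, LogSeries.mode_zero, LinearMap.zero_apply,
      smul_zero]

/-- If `L(-1)` maps into `V₊`, or if no positivity is required in `C_n`, then `C_{n+1} ⊆ C_n`. -/
theorem C_succ_le (M : WeakTwistedModule A g W) {n : ℕ} (hn : 1 ≤ n)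
    (hpos : n = 1 → ∀ v, A.translation v ∈ A.positivePart) : M.C (n + 1) ≤ M.C n := by
  refine Submodule.span_le.mpr ?_
  rintro _ ⟨α, hα, u, hu, w, -, rfl⟩
  obtain ⟨K, hK⟩ := g.N_locally_nilpotent u
  -- The vector must vary: the induction hypothesis is applied to `N u`, which lies in the same
  -- sector and is killed by one power of `N` fewer.
  induction K generalizing u with
  | zero => simp_all [LogSeries.mode_zero]
  | succ K ih =>
    have hNu := ih (g.N u) (VertexOperatorAlgebra.Automorphism.mem_sector_of_commute
      g.commute_S_N hu) (by rwa [pow_succ] at hK)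
    have hDu : (M.Y (A.translation u)).mode (α - n) 0 w ∈ M.C n :=
      Submodule.subset_span ⟨α, hα, _, VertexOperatorAlgebra.Automorphism.mem_sector_of_commute
        g.commute_S_translation hu, w, fun h => hpos h u, rfl⟩
    have h := M.mode_translation hu (-n) w
    have e1 : α + ((-n : ℤ) : ℂ) = α - n := by push_cast; ring
    have e2 : α - (n : ℂ) - 1 = α - (n + 1 : ℕ) := by push_cast; ring
    rw [e1, e2] at h
    -- Vanishing would force `Re α = n ≥ 1`, against the normalization `Re α < 1`.
    have hc : -(α - (n : ℂ)) ≠ 0 := by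
      intro h0
      have hre := congrArg Complex.re h0
      have hlt := VertexOperatorAlgebra.Automorphism.re_lt_one_of_mem_spectrumS hα
      have hn' : (1 : ℝ) ≤ n := by exact_mod_cast hn
      simp at hre
      linarith
    refine (Submodule.smul_mem_iff _ hc).mp ?_
    rw [sub_eq_iff_eq_add.mp h.symm]
    exact Submodule.add_mem _ hDu hNu

/-- The quotient by the smaller subspace surjects onto the quotient by the larger one. -/
theorem IsCofinite.of_le {M : WeakTwistedModule A g W} {m n : ℕ} (h : M.IsCofinite m)
    (hle : M.C m ≤ M.C n) : M.IsCofinite n := by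
  have : FiniteDimensional ℂ (W ⧸ M.C m) := h
  exact Module.Finite.of_surjective _ (Submodule.factor_surjective hle)

end WeakTwistedModule

theorem mainTheorem4 {V : Type*} [AddCommGroup V] [Module ℂ V] (A : VertexOperatorAlgebra V)
    (g : A.Automorphism) {W : Type*} [AddCommGroup W] [Module ℂ W]
    (M : WeakTwistedModule A g W) :
    (∀ n : ℕ, 3 ≤ n → M.C n ≤ M.C (n - 1) ∧ (M.IsCofinite n → M.IsCofinite (n - 1))) ∧
      (A.IsCFTType → M.IsCofinite 2 → M.IsCofinite 1) := by
  refine ⟨fun n hn => ?_, fun hA h => h.of_le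
    (M.C_succ_le le_rfl fun _ => hA.translation_mem_positivePart)⟩
  obtain ⟨k, rfl⟩ : ∃ k, n = k + 1 := ⟨n - 1, by omega⟩
  -- Here `k ≥ 2`, so the positivity condition is vacuous and no CFT-type assumption is needed.
  have hle : M.C (k + 1) ≤ M.C k := M.C_succ_le (by omega) fun h => by omega
  exact ⟨hle, fun h => h.of_le hle⟩
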